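/- Let $r,n\ge 1$ be integers, $\eta\in[0,1]$, and let $\Delta^r=\{x\in\mathbb R^r : x\ge 0,\ e^\top x=1\}$, where $e$ is the all-ones vector. For a matrix $A$, let $\operatorname{conv}(A)$ denote the convex hull of its columns. A matrix $H\in\mathbb R^{r\times n}$ is *column stochastic* if all of its columns lie in $\Delta^r$, and *$\eta$-expanded* if $$\Delta^r\cap\Big\{x\in\mathbb R^r : x\le \big[\eta+(1-\eta)\tfrac 2r\big]e\Big\}\subseteq\operatorname{conv}(H).$$ If the columns of $P\in\mathbb R^{(r-1)\times r}$ are the vertices of a simplex containing the origin in its interior, a *polar matrix* of $P$ is a matrix $\Theta\in\mathbb R^{(r-1)\times r}$ whose columns are the vertices, each listed once, of the polar $\operatorname{conv}(P)^*=\{\theta\in\mathbb R^{r-1} : \theta^\top x\le 1 \text{ for all } x\in\operatorname{conv}(P)\}$; it is determined up to a permutation of its columns. **Theorem.** Suppose that $Y=PH\in\mathbb R^{(r-1)\times n}$, where $P\in\mathbb R^{(r-1)\times r}$ has full rank $r-1$ and $H\in\mathbb R^{r\times n}$ is column stochastic and $\eta$-expanded. Let $q\in\mathbb R^r$ satisfy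 $Pq=0$ and $e^\top q=1$. If, entrywise, $$0<q<\frac{r\eta+2(1-\eta)}{2r}\,e,$$ then the columns of $P$ are the vertices of a simplex containing the origin in its interior, so that $P$ has a polar matrix, and the problem $$\max_{\Theta\in\mathbb R^{(r-1)\times r}}\ \operatorname{vol}\big(\operatorname{conv}(\Theta)\big)\quad\text{such that}\quad Y^\top\Theta\le 1_{n\times r}\ \text{(entrywise)},$$ where $\operatorname{vol}$ is the Lebesgue measure on $\mathbb R^{r-1}$ and $1_{n\times r}$ is the all-ones matrix, is solved uniquely, up to a permutation of the columns of $\Theta$, by the polar matrix of $P$: if $\Theta_0$ is any polar matrix of $P$, the set of global maximizers is exactly the set of matrices obtained from $\Theta_0$ by permuting its columns. -/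

import Mathlib

/-- The convex hull `conv(A)` of the columns of a matrix `A`. -/
def colHull {d k : ℕ} (A : Matrix (Fin d) (Fin k) ℝ) : Set (Fin d → ℝ) :=
  convexHull ℝ (Set.range A.col)

/-- `H` is column stochastic: every column lies in the unit simplex. -/
def IsColStochastic {r n : ℕ} (H : Matrix (Fin r) (Fin n) ℝ) : Prop :=
  ∀ j, H.col j ∈ stdSimplex ℝ (Fin r)

/-- The truncated simplex `Δ ∩ {x | x ≤ [η + (1 - η) (2 / r)] e}`. -/
def truncatedSimplex (r : ℕ) (η : ℝ) : Set (Fin r → ℝ) :=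
  stdSimplex ℝ (Fin r) ∩ {x | ∀ i, x i ≤ η + (1 - η) * (2 / (r : ℝ))}

/-- `H` is `η`-expanded. -/
def IsExpanded {r n : ℕ} (η : ℝ) (H : Matrix (Fin r) (Fin n) ℝ) : Prop :=
  truncatedSimplex r η ⊆ colHull H

/-- The polar `{θ | θᵀ x ≤ 1 for all x ∈ S}` of a set `S`. -/
def polarSet {d : ℕ} (S : Set (Fin d → ℝ)) : Set (Fin d → ℝ) :=
  {θ | ∀ x ∈ S, θ ⬝ᵥ x ≤ 1}

/-- `Θ` is a polar matrix of `P`: the columns of `P` are the vertices of a simplex which contains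
the origin in its interior, and the columns of `Θ` list the vertices of the polar of that simplex,
each of them once. -/
structure IsPolarMatrix {d k : ℕ} (P Θ : Matrix (Fin d) (Fin k) ℝ) : Prop where
  simplex : AffineIndependent ℝ P.col
  origin_mem : (0 : Fin d → ℝ) ∈ interior (colHull P)
  injective : Function.Injective Θ.col
  range_eq : Set.range Θ.col = Set.extremePoints ℝ (polarSet (colHull P))

/-- The feasible set `{Θ | Yᵀ Θ ≤ 1}` (entrywise) of the dual maximum-volume problem. -/
def dualFeasible (r : ℕ) {n : ℕ} (Y : Matrix (Fin (r - 1)) (Fin n) ℝ) :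
    Set (Matrix (Fin (r - 1)) (Fin r) ℝ) :=
  {Θ | ∀ j k, (Y.transpose * Θ) j k ≤ 1}

/-- `Θ` is a global maximizer of the (Lebesgue) volume of `conv(Θ)` over the feasible set. -/
def IsDualMaxVol {r n : ℕ} (Y : Matrix (Fin (r - 1)) (Fin n) ℝ)
    (Θ : Matrix (Fin (r - 1)) (Fin r) ℝ) : Prop :=
  Θ ∈ dualFeasible r Y ∧
    IsMaxOn (fun Ψ : Matrix (Fin (r - 1)) (Fin r) ℝ => MeasureTheory.volume (colHull Ψ))
      (dualFeasible r Y) Θ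

/-! Put `u = η + (1 - η) 2/r`; the bound on `q` reads `q < u/2`. Replace `Θ` by `W = diag(q) (1 - Pᵀ
Θ)`, which is `slackMatrix P q` times the homogenization of `Θ`. The first factor is a fixed
invertible matrix, so maximizing the volume means maximizing `|det W|`, and the columns of `W` sum
to `1` because `Pq = 0`. The polar matrices correspond to permutation matrices `W`.

Feasibility and expandedness make each column `v` of `1 - Pᵀ Θ` nonnegative against the truncated
simplex. By `exists_nonneg_combination_le`, `v` is then a nonnegative combination of the `e_k` and
`u e - e_k`. Scaled by `q`, these generators have Euclidean norm at most their coordinate sum,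
strictly for the second kind (`norm_facet_vector_lt`, where `q < u/2` enters). So every column of
`W` lies in the unit ball, and on the sphere only if it is a coordinate vector
(`norm_scaled_slack_le_one`). Hadamard's inequality gives `|det W| ≤ 1`, with equality only for
permutation matrices. -/

/-! ### Norm bound for scaled slack vectors -/

/-- A vector whose product with every point of the truncated simplex is nonnegative dominates a
nonnegative combination of the normals `u e - e_i` of the upper bounds. -/
theorem exists_nonneg_combination_le {ι : Type*} [Fintype ι] {u : ℝ} (hu : 0 ≤ u)
    (hcard : 1 ≤ u * Fintype.card ι) (v : ι → ℝ)
    (hv : ∀ x ∈ stdSimplex ℝ ι, (∀ i, x i ≤ u) → 0 ≤ v ⬝ᵥ x) :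
    ∃ b : ι → ℝ, (∀ i, 0 ≤ b i) ∧ ∀ i, u * ∑ j, b j - b i ≤ v i := by
  classical
  have hne : Nonempty ι := by
    by_contra h
    rw [not_nonempty_iff] at h
    simp at hcard
    linarith
  obtain ⟨m, -, hm⟩ := Finset.exists_max_image Finset.univ v Finset.univ_nonempty
  -- Greedy minimization of `v ⬝ᵥ x` over the truncated simplex: `t` is the least entry at which
  -- mass `u` on all entries up to `t` reaches total mass `1`.
  have hS : (Finset.univ.filter fun i => 1 ≤ u * ((Finset.univ.filter
      fun j => v j ≤ v i).card : ℝ)).Nonempty := by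
    refine ⟨m, Finset.mem_filter.2 ⟨Finset.mem_univ _, ?_⟩⟩
    rw [Finset.filter_true_of_mem fun j hj => hm j hj]
    simpa using hcard
  obtain ⟨i₀, hi₀, hmin⟩ := Finset.exists_min_image _ v hS
  set t := v i₀ with ht
  set A := Finset.univ.filter fun j => v j < t with hA
  set B := Finset.univ.filter fun j => v j = t with hB
  have hAB : 1 ≤ u * ((A.card : ℝ) + B.card) := by
    have h1 := (Finset.mem_filter.1 hi₀).2
    have h2 : (Finset.univ.filter fun j => v j ≤ v i₀) = A ∪ B := by
      ext j; simp [A, B, ← ht, le_iff_lt_or_eq]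
    have h3 : Disjoint A B := by
      rw [Finset.disjoint_left]; intro j h4 h5
      simp only [A, B, Finset.mem_filter, Finset.mem_univ, true_and] at h4 h5
      exact h4.ne h5
    rw [h2, Finset.card_union_of_disjoint h3] at h1
    exact_mod_cast h1
  have hA1 : u * (A.card : ℝ) ≤ 1 := by
    by_contra! h
    have hAne : A.Nonempty := by
      rw [Finset.nonempty_iff_ne_empty]; rintro h0
      rw [h0] at h; simp at h; linarith
    obtain ⟨k, hk, hkmax⟩ := Finset.exists_max_image A v hAne
    have hkt : v k < t := (Finset.mem_filter.1 hk).2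
    have : A = Finset.univ.filter fun j => v j ≤ v k := by
      ext j
      simp only [A, Finset.mem_filter, Finset.mem_univ, true_and]
      exact ⟨fun hj => hkmax j (by simpa [A] using hj), fun hj => hj.trans_lt hkt⟩
    have h2 := hmin k (Finset.mem_filter.2 ⟨Finset.mem_univ _, by rw [← this]; exact h.le⟩)
    linarith
  have hBpos : (0 : ℝ) < B.card := by
    exact_mod_cast Finset.card_pos.2 ⟨i₀, by simp [B, ht]⟩
  set s : ℝ := (1 - u * A.card) / B.card with hs
  have hs0 : 0 ≤ s := div_nonneg (by linarith) hBpos.le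
  have hsu : s ≤ u := by rw [hs, div_le_iff₀ hBpos]; linarith
  have hsB : (B.card : ℝ) * s = 1 - u * A.card := by rw [hs]; field_simp
  -- The greedy minimizer: full mass below `t`, the remaining mass shared equally among the ties.
  let x : ι → ℝ := fun i => (if v i < t then u else 0) + if v i = t then s else 0
  have hx : ∀ i, 0 ≤ x i ∧ x i ≤ u := by
    intro i
    simp only [x]
    split_ifs with h1 h2 h2
    · exact absurd h2 h1.ne
    · simp [hu]
    · simp [hs0, hsu]
    · simp [hu]
  have hsum : ∑ i, x i = 1 := by
    simp only [x, Finset.sum_add_distrib, ← Finset.sum_filter, Finset.sum_const, nsmul_eq_mul]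
    rw [hsB]; ring
  have hvx : v ⬝ᵥ x = u * ∑ i ∈ A, v i + (1 - u * A.card) * t := by
    simp only [dotProduct, x, mul_add, mul_ite, mul_zero, Finset.sum_add_distrib,
      ← Finset.sum_filter]
    rw [← Finset.sum_mul, mul_comm u, ← hsB]
    congr 1
    rw [Finset.sum_congr rfl (g := fun _ => t * s)
      (fun i hi => by rw [(Finset.mem_filter.1 hi).2])]
    simp only [Finset.sum_const, nsmul_eq_mul]; ring
  have h0 := hv x ⟨fun i => (hx i).1, hsum⟩ fun i => (hx i).2
  -- With `b = (t - v)⁺` one has `v ⬝ᵥ x = t - u ∑ b`, so nonnegativity at `x` gives `u ∑ b ≤ t`.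
  refine ⟨fun i => if v i < t then t - v i else 0, fun i => ?_, fun i => ?_⟩
  · dsimp only; split_ifs with h <;> linarith
  · have hb : ∑ j, (if v j < t then t - v j else 0) = A.card * t - ∑ i ∈ A, v i := by
      rw [← Finset.sum_filter, Finset.sum_sub_distrib]; simp [A]
    dsimp only
    rw [hb]
    have : u * (A.card * t - ∑ i ∈ A, v i) ≤ t := by rw [hvx] at h0; linarith
    split_ifs with h <;> linarith

/-- For a largest entry `q m`, `∑ q² ≤ q m`, and `s (1 - s)` increases on `[0, 1/2]`, where all
entries lie. This reduces the claim to `2 q m < u`. -/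
theorem two_mul_mul_one_sub_lt {ι : Type*} [Fintype ι] {u : ℝ} (hu : u ≤ 1) {q : ι → ℝ}
    (hq : ∀ i, 0 < q i) (hsum : ∑ i, q i = 1) (hlt : ∀ i, q i < u / 2) (i : ι) :
    2 * (q i * (1 - q i)) < u * (1 - ∑ j, q j ^ 2) := by
  obtain ⟨m, -, hm⟩ := Finset.exists_max_image Finset.univ q ⟨i, Finset.mem_univ i⟩
  have h1 : ∑ j, q j ^ 2 ≤ q m := by
    calc ∑ j, q j ^ 2 ≤ ∑ j, q m * q j := Finset.sum_le_sum fun j hj => by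
          rw [pow_two]; exact mul_le_mul_of_nonneg_right (hm j hj) (hq j).le
      _ = q m := by rw [← Finset.mul_sum, hsum, mul_one]
  have h2 := hm i (Finset.mem_univ i)
  have h3 := hlt m
  have h4 := hlt i
  have h5 := hq m
  have h6 : q i * (1 - q i) ≤ q m * (1 - q m) := by nlinarith
  have h7 : 2 * q m * (1 - q m) < u * (1 - q m) :=
    mul_lt_mul_of_pos_right (by linarith) (by linarith)
  have h8 : u * (1 - q m) ≤ u * (1 - ∑ j, q j ^ 2) :=
    mul_le_mul_of_nonneg_left (by linarith) (by linarith)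
  linarith

/-- After squaring and cancelling `u`, this is `two_mul_mul_one_sub_lt`. The right side is the
coordinate sum of the vector. -/
theorem norm_facet_vector_lt {ι : Type*} [Fintype ι] [DecidableEq ι] {u : ℝ} (hu : u ≤ 1)
    {q : ι → ℝ} (hq : ∀ i, 0 < q i) (hsum : ∑ i, q i = 1) (hlt : ∀ i, q i < u / 2) (i : ι) :
    ‖WithLp.toLp 2 (fun j => u * q j - (Pi.single i (q i) : ι → ℝ) j)‖ < u - q i := by
  have hi := hq i
  have hi' := hlt i
  have key := two_mul_mul_one_sub_lt hu hq hsum hlt i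
  refine lt_of_pow_lt_pow_left₀ 2 (by linarith) ?_
  rw [EuclideanSpace.real_norm_sq_eq]
  have : ∑ j, (u * q j - (Pi.single i (q i) : ι → ℝ) j) ^ 2
      = u ^ 2 * ∑ j, q j ^ 2 - 2 * u * q i ^ 2 + q i ^ 2 := by
    have h : ∀ j, (u * q j - (Pi.single i (q i) : ι → ℝ) j) ^ 2
        = u ^ 2 * q j ^ 2 + (Pi.single i (q i ^ 2 - 2 * u * q i ^ 2) : ι → ℝ) j := by
      intro j
      by_cases hj : j = i
      · subst hj; simp; ring
      · simp [hj]; ring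
    simp only [h, Finset.sum_add_distrib, ← Finset.mul_sum, Finset.sum_pi_single', Finset.mem_univ,
      if_true]
    ring
  simp only [this]
  nlinarith

/-- The scaled slack vectors `w = q v` of the points in the dual of the truncated simplex lie in
the unit ball, and the only ones on the unit sphere are the coordinate vectors. -/
theorem norm_scaled_slack_le_one {ι : Type*} [Fintype ι] [DecidableEq ι] {u : ℝ} (hu : u ≤ 1)
    {q : ι → ℝ} (hq : ∀ i, 0 < q i) (hsum : ∑ i, q i = 1) (hlt : ∀ i, q i < u / 2)
    (v : ι → ℝ) (hv : ∀ x ∈ stdSimplex ℝ ι, (∀ i, x i ≤ u) → 0 ≤ v ⬝ᵥ x)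
    (hqv : ∑ i, q i * v i = 1) :
    ‖WithLp.toLp 2 (fun i => q i * v i)‖ ≤ 1 ∧
      (1 ≤ ‖WithLp.toLp 2 (fun i => q i * v i)‖ →
        ∃ k, (fun i => q i * v i) = Pi.single k 1) := by
  have hne : Nonempty ι := by
    by_contra h
    rw [not_nonempty_iff] at h
    simp at hsum
  have hu0 : 0 < u := by
    obtain ⟨i⟩ := hne
    linarith [hq i, hlt i]
  have hcard : 1 ≤ u * Fintype.card ι := by
    have : ∑ i, q i ≤ ∑ _i : ι, u := Finset.sum_le_sum fun i _ => by linarith [hlt i]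
    rw [hsum] at this
    simpa [mul_comm] using this
  obtain ⟨b, hb0, hb⟩ := exists_nonneg_combination_le hu0.le hcard v hv
  set a : ι → ℝ := fun i => v i - (u * ∑ j, b j - b i) with ha
  have ha0 : ∀ i, 0 ≤ a i := fun i => sub_nonneg.2 (hb i)
  let g : ι → EuclideanSpace ℝ ι := fun k => WithLp.toLp 2 fun j => u * q j - (Pi.single k (q k) : ι → ℝ) j
  have hw : WithLp.toLp 2 (fun i => q i * v i)
      = ∑ k, ((a k * q k) • EuclideanSpace.single k (1 : ℝ) + b k • g k) := by
    ext i
    simp only [g, WithLp.ofLp_sum, WithLp.ofLp_add, WithLp.ofLp_smul, Finset.sum_apply,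
      Pi.add_apply, Pi.smul_apply, smul_eq_mul, Finset.sum_add_distrib, mul_sub,
      Finset.sum_sub_distrib]
    rw [Finset.sum_eq_single i (fun j _ hj => by simp [hj.symm]) (by simp)]
    rw [Finset.sum_eq_single (f := fun k => b k * (Pi.single k (q k) : ι → ℝ) i) i
      (fun j _ hj => by simp [hj.symm]) (by simp)]
    rw [← Finset.sum_mul]
    simp [ha]
    ring
  have htot : ∑ k, (a k * q k + b k * (u - q k)) = 1 := by
    rw [← hqv]
    have h : ∀ k, a k * q k + b k * (u - q k)
        = q k * v k - (u * ∑ j, b j) * q k + u * b k := by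
      intro k; simp only [ha]; ring
    simp only [h, Finset.sum_add_distrib, Finset.sum_sub_distrib, ← Finset.mul_sum, hsum]
    ring
  have hterm : ∀ k, ‖(a k * q k) • EuclideanSpace.single k (1 : ℝ) + b k • g k‖
      ≤ a k * q k + b k * ‖g k‖ := by
    intro k
    refine (norm_add_le _ _).trans ?_
    rw [norm_smul, norm_smul, Real.norm_of_nonneg (hb0 k),
      Real.norm_of_nonneg (mul_nonneg (ha0 k) (hq k).le)]
    simp
  have hg : ∀ k, ‖g k‖ < u - q k := norm_facet_vector_lt hu hq hsum hlt
  have hle : ‖WithLp.toLp 2 (fun i => q i * v i)‖ ≤ ∑ k, (a k * q k + b k * ‖g k‖) := by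
    rw [hw]
    exact (norm_sum_le _ _).trans (Finset.sum_le_sum fun k _ => hterm k)
  have hmono : ∀ k, a k * q k + b k * ‖g k‖ ≤ a k * q k + b k * (u - q k) := fun k => by
    have := mul_le_mul_of_nonneg_left (hg k).le (hb0 k)
    linarith
  refine ⟨hle.trans ((Finset.sum_le_sum fun k _ => hmono k).trans htot.le), fun hone => ?_⟩
  -- A positive `b k` would make the triangle inequality estimate strict.
  have hbz : ∀ k, b k = 0 := by
    by_contra! h
    obtain ⟨k, hk⟩ := h
    have hkpos : 0 < b k := lt_of_le_of_ne (hb0 k) hk.symm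
    have := Finset.sum_lt_sum (s := Finset.univ) (fun k _ => hmono k) ⟨k, Finset.mem_univ k, by
      have := mul_lt_mul_of_pos_left (hg k) hkpos
      linarith⟩
    linarith
  have hv0 : ∀ i, 0 ≤ q i * v i := fun i => by
    have := ha0 i
    simp only [ha, hbz] at this
    simp at this
    exact mul_nonneg (hq i).le this
  have hsq : (1 : ℝ) ≤ ∑ i, (q i * v i) ^ 2 := by
    have := EuclideanSpace.real_norm_sq_eq (WithLp.toLp 2 (fun i => q i * v i))
    simp only at this
    rw [← this]
    exact one_le_pow₀ hone
  have hle1 : ∀ i, q i * v i ≤ 1 := fun i => by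
    rw [← hqv]; exact Finset.single_le_sum (fun j _ => hv0 j) (Finset.mem_univ i)
  -- Entries in `[0, 1]` with sum `1` and square sum at least `1` must be `0` or `1`.
  have h01 : ∀ i, (q i * v i) ^ 2 = q i * v i := by
    have hnn : ∀ i ∈ Finset.univ, 0 ≤ q i * v i - (q i * v i) ^ 2 := fun i _ => by
      nlinarith [hv0 i, hle1 i]
    have hz : ∑ i, (q i * v i - (q i * v i) ^ 2) = 0 :=
      le_antisymm (by rw [Finset.sum_sub_distrib]; linarith) (Finset.sum_nonneg hnn)
    intro i
    have := (Finset.sum_eq_zero_iff_of_nonneg hnn).1 hz i (Finset.mem_univ i)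
    linarith
  obtain ⟨k, hk⟩ : ∃ k, q k * v k ≠ 0 := by
    by_contra! h
    simp [h] at hqv
  have hk1 : q k * v k = 1 := by
    have := h01 k
    rw [pow_two] at this
    exact mul_right_cancel₀ hk (by rw [this, one_mul])
  refine ⟨k, funext fun i => ?_⟩
  by_cases hi : i = k
  · subst hi; simpa using hk1
  · rw [Pi.single_eq_of_ne hi]
    have h1 := Finset.add_sum_erase Finset.univ (fun j => q j * v j) (Finset.mem_univ k)
    have h2 := Finset.single_le_sum (s := Finset.univ.erase k) (f := fun j => q j * v j)
      (fun j _ => hv0 j) (Finset.mem_erase.2 ⟨hi, Finset.mem_univ i⟩)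
    linarith [hv0 i]

/-! ### Determinants and the volume of a simplex -/

/-- Hadamard's inequality for matrices whose columns lie in the unit ball. -/
theorem abs_det_le_prod_norm_col {n : ℕ} (W : Matrix (Fin n) (Fin n) ℝ) :
    |W.det| ≤ ∏ k, ‖WithLp.toLp 2 (W.col k)‖ := by
  have : Fact (Module.finrank ℝ (EuclideanSpace ℝ (Fin n)) = n) := ⟨by simp⟩
  let b := EuclideanSpace.basisFun (Fin n) ℝ
  have h := b.toBasis.orientation.abs_volumeForm_apply_le fun k => WithLp.toLp 2 (W.col k)
  rw [b.toBasis.orientation.volumeForm_robust' b] at h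
  refine le_trans (le_of_eq ?_) h
  rw [Module.Basis.det_apply]
  congr 2

theorem colHull_eq_image {d k : ℕ} (A : Matrix (Fin d) (Fin k) ℝ) :
    colHull A = A.mulVec '' stdSimplex ℝ (Fin k) := by
  rw [← convexHull_rangle_single_eq_stdSimplex]
  have := A.mulVecLin.image_convexHull (Set.range fun i : Fin k => (Pi.single i 1 : Fin k → ℝ))
  rw [Matrix.coe_mulVecLin] at this
  rw [this, ← Set.range_comp, colHull]
  congr 2
  ext i : 1
  simp

/-- The homogenization `[1; Θ]` of a matrix `Θ`. -/
def homogenize {d k : ℕ} (Θ : Matrix (Fin d) (Fin k) ℝ) : Matrix (Fin (d + 1)) (Fin k) ℝ :=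
  Matrix.of (Fin.cons 1 Θ)

theorem homogenize_zero {d k : ℕ} (Θ : Matrix (Fin d) (Fin k) ℝ) (j : Fin k) :
    homogenize Θ 0 j = 1 := rfl

theorem homogenize_succ {d k : ℕ} (Θ : Matrix (Fin d) (Fin k) ℝ) (a : Fin d) (j : Fin k) :
    homogenize Θ a.succ j = Θ a j := rfl

/-- Subtract column `0` from the others and expand along the row of ones. -/
theorem det_homogenize {d : ℕ} (Θ : Matrix (Fin d) (Fin (d + 1)) ℝ) :
    (homogenize Θ).det = (Matrix.of fun a b : Fin d => Θ a b.succ - Θ a 0).det := by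
  rw [← Matrix.det_transpose, Matrix.det_eq_of_forall_row_eq_smul_add_const
    (B := Matrix.of fun i a : Fin (d + 1) =>
      if i = 0 then homogenize Θ a 0 else homogenize Θ a i - homogenize Θ a 0)
    (fun i => if i = 0 then 0 else 1) 0 (by simp)
    (fun i j => by by_cases hi : i = 0 <;> simp [hi])]
  rw [Matrix.det_succ_column_zero, Fin.sum_univ_succ]
  simp only [homogenize_zero, Matrix.of_apply]
  simp only [Fin.succ_ne_zero, if_false, sub_self, if_true]
  rw [← Matrix.det_transpose (Matrix.of fun a b : Fin d => Θ a b.succ - Θ a 0)]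
  simp only [mul_zero, zero_mul, Finset.sum_const_zero, add_zero, Fin.val_zero, pow_zero, one_mul]
  congr 1

/-- The volume of the convex hull of `d + 1` points of `ℝ^d` is proportional to the determinant of
their homogenization. -/
theorem exists_volume_colHull_eq (d : ℕ) :
    ∃ c : ENNReal, c ≠ 0 ∧ c ≠ ⊤ ∧ ∀ Θ : Matrix (Fin d) (Fin (d + 1)) ℝ,
      MeasureTheory.volume (colHull Θ) = ENNReal.ofReal |(homogenize Θ).det| * c := by
  let f : (Fin (d + 1) → ℝ) → Fin d → ℝ := fun w a => w a.succ
  have hf : Continuous f := by fun_prop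
  -- The constant is the volume of the corner simplex `{x ≥ 0, ∑ x ≤ 1}`, of which `conv(Θ)` is an
  -- affine image.
  refine ⟨MeasureTheory.volume (f '' stdSimplex ℝ (Fin (d + 1))), ?_, ?_, fun Θ => ?_⟩
  · have hopen : IsOpen ((Set.univ.pi fun _ => Set.Ioi 0) ∩ {x : Fin d → ℝ | ∑ i, x i < 1}) :=
      (isOpen_set_pi Set.finite_univ fun _ _ => isOpen_Ioi).inter
        (isOpen_lt (continuous_finsetSum _ fun i _ => continuous_apply i) continuous_const)
    refine ((hopen.measure_pos MeasureTheory.volume ⟨fun _ => 1 / (d + 1), fun i _ => ?_, ?_⟩).trans_le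
      (MeasureTheory.measure_mono ?_)).ne'
    · rw [Set.mem_Ioi]; positivity
    · simp only [Set.mem_ofPred_eq, Finset.sum_const, Finset.card_univ, Fintype.card_fin, nsmul_eq_mul]
      rw [mul_one_div, div_lt_one (by positivity)]
      linarith
    · rintro x ⟨hx, hx1⟩
      refine ⟨Fin.cons (1 - ∑ i, x i) x, ⟨fun i => ?_, ?_⟩, ?_⟩
      · refine Fin.cases ?_ (fun i => ?_) i
        · simp only [Fin.cons_zero]; exact sub_nonneg.2 hx1.le
        · simpa using (hx i trivial).le
      · simp [Fin.sum_univ_succ]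
      · ext a; simp [f]
  · exact ((isCompact_stdSimplex ℝ (Fin (d + 1))).image hf).measure_ne_top
  · set M := Matrix.of fun a b : Fin d => Θ a b.succ - Θ a 0 with hM
    have himg : colHull Θ
        = (fun x => Θ.col 0 + x) '' (M.mulVecLin '' (f '' stdSimplex ℝ (Fin (d + 1)))) := by
      rw [colHull_eq_image, Set.image_image, Set.image_image]
      refine Set.image_congr fun w hw => ?_
      ext a
      have h1 := hw.2
      rw [Fin.sum_univ_succ] at h1
      simp only [Matrix.mulVec, dotProduct, Matrix.mulVecLin_apply, Pi.add_apply, Matrix.col_apply,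
        hM, Matrix.of_apply, f, sub_mul, Finset.sum_sub_distrib, ← Finset.mul_sum]
      rw [Fin.sum_univ_succ, eq_sub_of_add_eq' h1]
      ring
    rw [himg, Set.image_add_left, MeasureTheory.measure_preimage_add,
      MeasureTheory.Measure.addHaar_image_linearMap, ← Matrix.toLin'_apply', LinearMap.det_toLin',
      det_homogenize]

/-! ### The slack matrix and the simplex of `P` -/

/-- The matrix `diag(q) [e, -Pᵀ]`, which sends the homogenization of `θ` to the vector of slacks
`1 - Pᵀ θ` scaled by `q`. -/
def slackMatrix {d k : ℕ} (P : Matrix (Fin d) (Fin k) ℝ) (q : Fin k → ℝ) :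
    Matrix (Fin k) (Fin (d + 1)) ℝ :=
  Matrix.of fun i => Fin.cons (q i) fun a => -(q i * P a i)

theorem slackMatrix_mulVec {d k : ℕ} (P : Matrix (Fin d) (Fin k) ℝ) (q : Fin k → ℝ)
    (z : Fin (d + 1) → ℝ) (i : Fin k) :
    (slackMatrix P q).mulVec z i = q i * (z 0 - P.col i ⬝ᵥ fun a => z a.succ) := by
  simp only [slackMatrix, Matrix.mulVec, dotProduct, Matrix.of_apply, Fin.sum_univ_succ,
    Fin.cons_zero, Fin.cons_succ, neg_mul, Finset.sum_neg_distrib, Matrix.col_apply, mul_sub,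
    Finset.mul_sum, mul_assoc]
  ring

theorem slackMatrix_mul_homogenize {d k l : ℕ} (P : Matrix (Fin d) (Fin k) ℝ) (q : Fin k → ℝ)
    (Θ : Matrix (Fin d) (Fin l) ℝ) (i : Fin k) (j : Fin l) :
    (slackMatrix P q * homogenize Θ) i j = q i * (1 - P.col i ⬝ᵥ Θ.col j) :=
  slackMatrix_mulVec P q (fun a => homogenize Θ a j) i

theorem vecMul_slackMatrix {d k : ℕ} (P : Matrix (Fin d) (Fin k) ℝ) {q : Fin k → ℝ}
    (hPq : P.mulVec q = 0) (hq : ∑ i, q i = 1) :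
    Matrix.vecMul 1 (slackMatrix P q) = Pi.single 0 1 := by
  ext a
  refine Fin.cases ?_ (fun a => ?_) a
  · simpa [Matrix.vecMul, dotProduct, slackMatrix] using hq
  · have := congrFun hPq a
    simpa [Matrix.vecMul, Matrix.mulVec, dotProduct, slackMatrix, mul_comm] using this

theorem sum_slackMatrix_mulVec {d k : ℕ} (P : Matrix (Fin d) (Fin k) ℝ) {q : Fin k → ℝ}
    (hPq : P.mulVec q = 0) (hq : ∑ i, q i = 1) (z : Fin (d + 1) → ℝ) :
    ∑ i, (slackMatrix P q).mulVec z i = z 0 := by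
  have := Matrix.dotProduct_mulVec 1 (slackMatrix P q) z
  rw [vecMul_slackMatrix P hPq hq] at this
  simpa [dotProduct, Pi.single_apply] using this

/-- A kernel vector has first coordinate `0`, since that is the sum of its image; the rest is then
killed by `Pᵀ`, which is injective by the rank hypothesis. -/
theorem det_slackMatrix_ne_zero {d : ℕ} {P : Matrix (Fin d) (Fin (d + 1)) ℝ} (hP : P.rank = d)
    {q : Fin (d + 1) → ℝ} (hPq : P.mulVec q = 0) (hq : ∑ i, q i = 1) (hq_pos : ∀ i, 0 < q i) :
    (slackMatrix P q).det ≠ 0 := by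
  intro h0
  obtain ⟨z, hz, hz0⟩ := Matrix.exists_mulVec_eq_zero_iff.2 h0
  have hzz : z 0 = 0 := by
    rw [← sum_slackMatrix_mulVec P hPq hq z, hz0]; simp
  have hrow : LinearIndependent ℝ P.row := by
    rw [linearIndependent_iff_card_eq_finrank_span, Set.finrank, ← Matrix.rank_eq_finrank_span_row,
      hP, Fintype.card_fin]
  rw [Fintype.linearIndependent_iff] at hrow
  have hs := hrow (fun a => z a.succ) (by
    ext i
    have := congrFun hz0 i
    rw [slackMatrix_mulVec, hzz] at this
    have h2 : P.col i ⬝ᵥ (fun a => z a.succ) = 0 := by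
      rcases mul_eq_zero.1 this with h | h
      · exact absurd h (hq_pos i).ne'
      · linarith
    simpa [dotProduct, mul_comm] using h2)
  exact hz (funext fun a => Fin.cases hzz hs a)

/-- An affine dependence among the columns, divided entrywise by `q`, is a left null vector of the
slack matrix. -/
theorem affineIndependent_col {d : ℕ} {P : Matrix (Fin d) (Fin (d + 1)) ℝ} {q : Fin (d + 1) → ℝ}
    (hq_pos : ∀ i, 0 < q i) (hdet : (slackMatrix P q).det ≠ 0) :
    AffineIndependent ℝ P.col := by
  rw [affineIndependent_iff_of_fintype]
  intro w hw hPw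
  rw [Finset.weightedVSub_eq_linear_combination _ hw] at hPw
  by_contra! h
  obtain ⟨i, hi⟩ := h
  refine hdet (Matrix.exists_vecMul_eq_zero_iff.1 ⟨fun j => w j / q j, fun h0 => ?_, ?_⟩)
  · have := congrFun h0 i
    simp [hi, (hq_pos i).ne'] at this
  · have hc : ∀ j, w j / q j * q j = w j := fun j => div_mul_cancel₀ _ (hq_pos j).ne'
    ext a
    refine Fin.cases ?_ (fun a => ?_) a
    · simpa [Matrix.vecMul, dotProduct, slackMatrix, hc] using hw
    · have := congrFun hPw a
      simp only [Finset.sum_apply, Pi.smul_apply, smul_eq_mul, Matrix.col_apply,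
        Pi.zero_apply] at this
      simpa [Matrix.vecMul, dotProduct, slackMatrix, ← mul_assoc, hc] using this

/-- The entries of `q` are the barycentric coordinates of the origin, all positive. -/
theorem zero_mem_interior_colHull {d : ℕ} {P : Matrix (Fin d) (Fin (d + 1)) ℝ}
    (hP : AffineIndependent ℝ P.col) {q : Fin (d + 1) → ℝ} (hPq : P.mulVec q = 0)
    (hq : ∑ i, q i = 1) (hq_pos : ∀ i, 0 < q i) :
    (0 : Fin d → ℝ) ∈ interior (colHull P) := by
  let b : AffineBasis (Fin (d + 1)) ℝ (Fin d → ℝ) :=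
    ⟨P.col, hP, hP.affineSpan_eq_top_iff_card_eq_finrank_add_one.2 (by simp)⟩
  have hb : ⇑b = P.col := rfl
  rw [colHull, ← hb, b.interior_convexHull]
  intro i
  have h0 : (0 : Fin d → ℝ) = Finset.univ.affineCombination ℝ b q := by
    rw [Finset.affineCombination_eq_linear_combination _ _ _ hq, ← hPq]
    ext a
    simp [Matrix.mulVec, dotProduct, hb, mul_comm]
  rw [h0, b.coord_apply_combination_of_mem (Finset.mem_univ i) hq]
  exact hq_pos i

theorem homogenize_mulVec {d k : ℕ} (Θ : Matrix (Fin d) (Fin k) ℝ) (w : Fin k → ℝ) :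
    (homogenize Θ).mulVec w = Fin.cons (∑ i, w i) (Θ.mulVec w) := by
  ext a
  refine Fin.cases ?_ (fun a => ?_) a
  · simp [Matrix.mulVec, dotProduct, homogenize_zero]
  · simp [Matrix.mulVec, dotProduct, homogenize_succ]

/-- Every square matrix with column sums `1` consists of the scaled slacks of some `Θ`. -/
theorem exists_slackMatrix_mul_homogenize_eq {d : ℕ} {P : Matrix (Fin d) (Fin (d + 1)) ℝ}
    {q : Fin (d + 1) → ℝ} (hPq : P.mulVec q = 0) (hq : ∑ i, q i = 1)
    (hdet : (slackMatrix P q).det ≠ 0) {k : ℕ} (W : Matrix (Fin (d + 1)) (Fin k) ℝ)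
    (hW : ∀ j, ∑ i, W i j = 1) :
    ∃ Θ : Matrix (Fin d) (Fin k) ℝ, slackMatrix P q * homogenize Θ = W := by
  have hunit : IsUnit (slackMatrix P q).det := isUnit_iff_ne_zero.2 hdet
  set V := (slackMatrix P q)⁻¹ * W with hV
  have hBV : slackMatrix P q * V = W := Matrix.mul_nonsing_inv_cancel_left _ _ hunit
  refine ⟨Matrix.of fun a j => V a.succ j, ?_⟩
  have : homogenize (Matrix.of fun a j => V a.succ j) = V := by
    ext a j
    refine Fin.cases ?_ (fun a => ?_) a
    · rw [homogenize_zero, ← hW j, ← hBV]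
      exact sum_slackMatrix_mulVec P hPq hq fun a => V a j
    · rfl
  rw [this, hBV]

theorem mem_polarSet_colHull {d k : ℕ} {P : Matrix (Fin d) (Fin k) ℝ} {θ : Fin d → ℝ} :
    θ ∈ polarSet (colHull P) ↔ ∀ i, P.col i ⬝ᵥ θ ≤ 1 := by
  have hconv : Convex ℝ {x : Fin d → ℝ | θ ⬝ᵥ x ≤ 1} :=
    convex_halfSpace_le (f := fun x => θ ⬝ᵥ x)
      ⟨fun x y => dotProduct_add _ _ _, fun c x => dotProduct_smul _ _ _⟩ 1
  have : colHull P ⊆ {x | θ ⬝ᵥ x ≤ 1} ↔ ∀ i, P.col i ⬝ᵥ θ ≤ 1 := by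
    rw [colHull, hconv.convexHull_subset_iff, Set.range_subset_iff]
    simp only [Set.mem_ofPred_eq, dotProduct_comm]
  exact this

theorem slackMatrix_mulVec_nonneg_iff {d k : ℕ} {P : Matrix (Fin d) (Fin k) ℝ} {q : Fin k → ℝ}
    (hq_pos : ∀ i, 0 < q i) {θ : Fin d → ℝ} :
    (∀ i, 0 ≤ (slackMatrix P q).mulVec (Fin.cons 1 θ) i) ↔ θ ∈ polarSet (colHull P) := by
  rw [mem_polarSet_colHull]
  refine forall_congr' fun i => ?_
  rw [slackMatrix_mulVec]
  simp only [Fin.cons_zero, Fin.cons_succ]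
  rw [mul_nonneg_iff_of_pos_left (hq_pos i), sub_nonneg]

/-! ### The polar simplex in slack coordinates -/

section Polar

variable {d : ℕ} {P Θ : Matrix (Fin d) (Fin (d + 1)) ℝ} {q : Fin (d + 1) → ℝ}

/-- As the homogenization of `Θ` inverts the slack matrix, the scaled slacks of `θ` are its
barycentric coordinates with respect to the columns of `Θ`. -/
theorem mulVec_slackMatrix_mulVec (hΘ : slackMatrix P q * homogenize Θ = 1) (θ : Fin d → ℝ) :
    Θ.mulVec ((slackMatrix P q).mulVec (Fin.cons 1 θ)) = θ := by
  have h : (homogenize Θ).mulVec ((slackMatrix P q).mulVec (Fin.cons 1 θ)) = Fin.cons 1 θ := by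
    rw [Matrix.mulVec_mulVec, mul_eq_one_comm.1 hΘ, Matrix.one_mulVec]
  rw [homogenize_mulVec] at h
  exact (Fin.cons_injective2 h).2

theorem slackMatrix_mulVec_mulVec (hΘ : slackMatrix P q * homogenize Θ = 1)
    {w : Fin (d + 1) → ℝ} (hw : ∑ i, w i = 1) :
    (slackMatrix P q).mulVec (Fin.cons 1 (Θ.mulVec w)) = w := by
  rw [← hw, ← homogenize_mulVec, Matrix.mulVec_mulVec, hΘ, Matrix.one_mulVec]

theorem colHull_eq_polarSet (hPq : P.mulVec q = 0) (hq : ∑ i, q i = 1) (hq_pos : ∀ i, 0 < q i)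
    (hΘ : slackMatrix P q * homogenize Θ = 1) :
    colHull Θ = polarSet (colHull P) := by
  rw [colHull_eq_image]
  ext θ
  constructor
  · rintro ⟨w, hw, rfl⟩
    rw [← slackMatrix_mulVec_nonneg_iff hq_pos, slackMatrix_mulVec_mulVec hΘ hw.2]
    exact hw.1
  · intro hθ
    refine ⟨_, ⟨(slackMatrix_mulVec_nonneg_iff hq_pos).2 hθ, ?_⟩, mulVec_slackMatrix_mulVec hΘ θ⟩
    rw [sum_slackMatrix_mulVec P hPq hq, Fin.cons_zero]

theorem slackMatrix_mulVec_col (hΘ : slackMatrix P q * homogenize Θ = 1) (k : Fin (d + 1)) :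
    (slackMatrix P q).mulVec (Fin.cons 1 (Θ.col k)) = Pi.single k 1 := by
  rw [← Matrix.mulVec_single_one, slackMatrix_mulVec_mulVec hΘ (by simp)]

theorem col_mem_extremePoints_polarSet (hPq : P.mulVec q = 0) (hq : ∑ i, q i = 1)
    (hq_pos : ∀ i, 0 < q i) (hΘ : slackMatrix P q * homogenize Θ = 1) (k : Fin (d + 1)) :
    Θ.col k ∈ Set.extremePoints ℝ (polarSet (colHull P)) := by
  rw [mem_extremePoints_iff_left]
  refine ⟨?_, fun x hx y hy hxy => ?_⟩
  · rw [← colHull_eq_polarSet hPq hq hq_pos hΘ]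
    exact subset_convexHull ℝ _ ⟨k, rfl⟩
  · obtain ⟨a, b, ha, hb, hab, he⟩ := hxy
    have hx0 := (slackMatrix_mulVec_nonneg_iff hq_pos).2 hx
    have hy0 := (slackMatrix_mulVec_nonneg_iff hq_pos).2 hy
    have hcomb : a • (slackMatrix P q).mulVec (Fin.cons 1 x)
        + b • (slackMatrix P q).mulVec (Fin.cons 1 y) = Pi.single k 1 := by
      rw [← slackMatrix_mulVec_col hΘ k, ← he, ← Matrix.mulVec_smul, ← Matrix.mulVec_smul,
        ← Matrix.mulVec_add]
      congr 1
      ext i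
      refine Fin.cases ?_ (fun i => ?_) i
      · simpa using hab
      · simp
    -- Slacks are nonnegative on the polar, so a positive combination vanishes only if each term
    -- does.
    have hz : ∀ i, i ≠ k → (slackMatrix P q).mulVec (Fin.cons 1 x) i = 0 := fun i hi => by
      have h := congrFun hcomb i
      simp only [Pi.add_apply, Pi.smul_apply, smul_eq_mul, Pi.single_eq_of_ne hi] at h
      have h1 := mul_nonneg ha.le (hx0 i)
      have h2 := mul_nonneg hb.le (hy0 i)
      exact (mul_eq_zero.1 (by linarith : a * _ = 0)).resolve_left ha.ne'
    have hk : (slackMatrix P q).mulVec (Fin.cons 1 x) k = 1 := by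
      rw [← Finset.sum_eq_single (f := (slackMatrix P q).mulVec (Fin.cons 1 x)) (s := Finset.univ) k
        (fun i _ hi => hz i hi) (by simp), sum_slackMatrix_mulVec P hPq hq, Fin.cons_zero]
    have hs : (slackMatrix P q).mulVec (Fin.cons 1 x) = Pi.single k 1 := by
      ext i
      by_cases hi : i = k
      · subst hi; simpa using hk
      · rw [hz i hi, Pi.single_eq_of_ne hi]
    rw [← mulVec_slackMatrix_mulVec hΘ x, hs, Matrix.mulVec_single_one]

theorem isPolarMatrix_of_slackMatrix_mul (hPq : P.mulVec q = 0) (hq : ∑ i, q i = 1)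
    (hq_pos : ∀ i, 0 < q i) (hdet : (slackMatrix P q).det ≠ 0)
    (hΘ : slackMatrix P q * homogenize Θ = 1) : IsPolarMatrix P Θ where
  simplex := affineIndependent_col hq_pos hdet
  origin_mem := zero_mem_interior_colHull (affineIndependent_col hq_pos hdet) hPq hq hq_pos
  injective := fun k l hkl => by
    have h := slackMatrix_mulVec_col hΘ k
    rw [hkl, slackMatrix_mulVec_col hΘ l] at h
    by_contra hne
    have := congrFun h l
    simp [Pi.single_eq_of_ne (Ne.symm hne)] at this
  range_eq := by
    refine Set.Subset.antisymm ?_ ?_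
    · rintro _ ⟨k, rfl⟩
      exact col_mem_extremePoints_polarSet hPq hq hq_pos hΘ k
    · rw [← colHull_eq_polarSet hPq hq hq_pos hΘ]
      exact extremePoints_convexHull_subset

end Polar

theorem IsPolarMatrix.exists_submatrix_eq {d k : ℕ} {P Θ Θ' : Matrix (Fin d) (Fin k) ℝ}
    (h : IsPolarMatrix P Θ) (h' : IsPolarMatrix P Θ') :
    ∃ σ : Equiv.Perm (Fin k), Θ' = Θ.submatrix id σ := by
  have hr : ∀ j, ∃ i, Θ.col i = Θ'.col j := fun j => by
    have : Θ'.col j ∈ Set.range Θ.col := by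
      rw [h.range_eq, ← h'.range_eq]; exact ⟨j, rfl⟩
    exact this
  choose f hf using hr
  have hinj : Function.Injective f := fun i j hij => h'.injective (by rw [← hf, ← hf, hij])
  refine ⟨Equiv.ofBijective f (Finite.injective_iff_bijective.1 hinj), ?_⟩
  ext a j
  exact (congrFun (hf j) a).symm

/-! ### Permutations and feasibility -/

theorem colHull_submatrix {d k : ℕ} (Θ : Matrix (Fin d) (Fin k) ℝ) (σ : Equiv.Perm (Fin k)) :
    colHull (Θ.submatrix id σ) = colHull Θ := by
  have : (Θ.submatrix id σ).col = Θ.col ∘ σ := rfl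
  rw [colHull, this, σ.surjective.range_comp, colHull]

theorem mem_dualFeasible_submatrix {r n : ℕ} {Y : Matrix (Fin (r - 1)) (Fin n) ℝ}
    {Θ : Matrix (Fin (r - 1)) (Fin r) ℝ} (σ : Equiv.Perm (Fin r)) (h : Θ ∈ dualFeasible r Y) :
    Θ.submatrix id σ ∈ dualFeasible r Y := fun j k => h j (σ k)

theorem transpose_mul_mul_apply {d k n : ℕ} (P : Matrix (Fin d) (Fin k) ℝ)
    (H : Matrix (Fin k) (Fin n) ℝ) {l : ℕ} (Θ : Matrix (Fin d) (Fin l) ℝ) (j : Fin n) (m : Fin l) :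
    ((P * H).transpose * Θ) j m = (fun i => P.col i ⬝ᵥ Θ.col m) ⬝ᵥ H.col j := by
  rw [Matrix.transpose_mul, Matrix.mul_assoc, Matrix.mul_apply, dotProduct]
  exact Finset.sum_congr rfl fun i _ => mul_comm _ _

theorem mem_dualFeasible_of_slackMatrix_mul {d n : ℕ} {P Θ : Matrix (Fin d) (Fin (d + 1)) ℝ}
    {q : Fin (d + 1) → ℝ} {H : Matrix (Fin (d + 1)) (Fin n) ℝ} (hH : IsColStochastic H)
    (hq_pos : ∀ i, 0 < q i) (hΘ : slackMatrix P q * homogenize Θ = 1) :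
    Θ ∈ dualFeasible (d + 1) (P * H) := by
  intro j k
  have hle : ∀ i, P.col i ⬝ᵥ Θ.col k ≤ 1 := by
    rw [← mem_polarSet_colHull, ← slackMatrix_mulVec_nonneg_iff hq_pos, slackMatrix_mulVec_col hΘ]
    intro i
    by_cases hi : i = k
    · subst hi; simp
    · rw [Pi.single_eq_of_ne hi]
  refine (transpose_mul_mul_apply P H Θ j k).trans_le ?_
  rw [← (hH j).2, dotProduct]
  exact Finset.sum_le_sum fun i _ => mul_le_of_le_one_left ((hH j).1 i) (hle i)

/-- Feasibility puts `Pᵀ θ` in the polar of `conv(H)`, hence in that of the truncated simplex, where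
coordinates sum to `1`. -/
theorem slack_dotProduct_nonneg_of_mem_dualFeasible {d n : ℕ} {η : ℝ}
    {P Θ : Matrix (Fin d) (Fin (d + 1)) ℝ}
    {H : Matrix (Fin (d + 1)) (Fin n) ℝ} (hHη : IsExpanded η H)
    (hΘ : Θ ∈ dualFeasible (d + 1) (P * H)) (k : Fin (d + 1))
    {x : Fin (d + 1) → ℝ} (hx : x ∈ truncatedSimplex (d + 1) η) :
    0 ≤ (fun i => 1 - P.col i ⬝ᵥ Θ.col k) ⬝ᵥ x := by
  have hmem : (fun i => P.col i ⬝ᵥ Θ.col k) ∈ polarSet (colHull H) := by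
    rw [mem_polarSet_colHull]
    intro j
    rw [dotProduct_comm, ← transpose_mul_mul_apply]
    exact hΘ j k
  have h := hmem x (hHη hx)
  have h1 := hx.1.2
  simp only [dotProduct, sub_mul, one_mul, Finset.sum_sub_distrib] at h ⊢
  rw [h1]
  linarith

/-! ### The maximizers -/

section Maximizer

variable {d n : ℕ} {η : ℝ} {P Θ : Matrix (Fin d) (Fin (d + 1)) ℝ} {q : Fin (d + 1) → ℝ}
  {H : Matrix (Fin (d + 1)) (Fin n) ℝ}

theorem norm_slack_col_le_one (hη : η ∈ Set.Icc (0 : ℝ) 1) (hHη : IsExpanded η H)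
    (hPq : P.mulVec q = 0) (hq : ∑ i, q i = 1) (hq_pos : ∀ i, 0 < q i)
    (hq_lt : ∀ i, q i < (η + (1 - η) * (2 / ((d + 1 : ℕ) : ℝ))) / 2)
    (hΘ : Θ ∈ dualFeasible (d + 1) (P * H)) (k : Fin (d + 1)) :
    ‖WithLp.toLp 2 ((slackMatrix P q * homogenize Θ).col k)‖ ≤ 1 ∧
      (1 ≤ ‖WithLp.toLp 2 ((slackMatrix P q * homogenize Θ).col k)‖ →
        ∃ l, (slackMatrix P q * homogenize Θ).col k = Pi.single l 1) := by
  have hcol : (slackMatrix P q * homogenize Θ).col k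
      = fun i => q i * (1 - P.col i ⬝ᵥ Θ.col k) :=
    funext fun i => slackMatrix_mul_homogenize P q Θ i k
  have hsum : ∑ i, q i * (1 - P.col i ⬝ᵥ Θ.col k) = 1 := by
    have := sum_slackMatrix_mulVec P hPq hq fun a => homogenize Θ a k
    rw [homogenize_zero] at this
    exact (Finset.sum_congr rfl fun i _ => (slackMatrix_mul_homogenize P q Θ i k).symm).trans this
  -- For `r = 1` the bound would read `1 < 1 - η/2`. From `r ≥ 2` follows `u ≤ 1`.
  have hd : 1 ≤ d := by
    by_contra! h0
    obtain rfl : d = 0 := by omega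
    have h1 := hq_lt 0
    simp at hq h1
    rw [hq] at h1
    linarith [hη.1]
  have hu : η + (1 - η) * (2 / ((d + 1 : ℕ) : ℝ)) ≤ 1 := by
    have h2 : (2 : ℝ) / ((d + 1 : ℕ) : ℝ) ≤ 1 := by
      rw [div_le_one (by positivity)]
      exact_mod_cast Nat.succ_le_succ hd
    nlinarith [hη.2]
  rw [hcol]
  exact norm_scaled_slack_le_one hu hq_pos hq hq_lt _
    (fun x hx hxu => slack_dotProduct_nonneg_of_mem_dualFeasible hHη hΘ k ⟨hx, hxu⟩) hsum

theorem abs_det_slack_le_one (hη : η ∈ Set.Icc (0 : ℝ) 1) (hHη : IsExpanded η H)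
    (hPq : P.mulVec q = 0) (hq : ∑ i, q i = 1) (hq_pos : ∀ i, 0 < q i)
    (hq_lt : ∀ i, q i < (η + (1 - η) * (2 / ((d + 1 : ℕ) : ℝ))) / 2)
    (hΘ : Θ ∈ dualFeasible (d + 1) (P * H)) :
    |(slackMatrix P q * homogenize Θ).det| ≤ 1 :=
  (abs_det_le_prod_norm_col _).trans (Finset.prod_le_one (fun _ _ => norm_nonneg _)
    fun k _ => (norm_slack_col_le_one hη hHη hPq hq hq_pos hq_lt hΘ k).1)

theorem exists_perm_of_one_le_abs_det_slack (hη : η ∈ Set.Icc (0 : ℝ) 1) (hHη : IsExpanded η H)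
    (hPq : P.mulVec q = 0) (hq : ∑ i, q i = 1) (hq_pos : ∀ i, 0 < q i)
    (hq_lt : ∀ i, q i < (η + (1 - η) * (2 / ((d + 1 : ℕ) : ℝ))) / 2)
    (hΘ : Θ ∈ dualFeasible (d + 1) (P * H))
    (hdet : 1 ≤ |(slackMatrix P q * homogenize Θ).det|) :
    ∃ σ : Equiv.Perm (Fin (d + 1)), ∀ k,
      (slackMatrix P q * homogenize Θ).col k = Pi.single (σ k) 1 := by
  have hnorm := norm_slack_col_le_one hη hHη hPq hq hq_pos hq_lt hΘ
  have hone : ∀ k, 1 ≤ ‖WithLp.toLp 2 ((slackMatrix P q * homogenize Θ).col k)‖ := by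
    by_contra! ⟨k, hk⟩
    have h1 := hdet.trans (abs_det_le_prod_norm_col _)
    rw [← Finset.mul_prod_erase _ _ (Finset.mem_univ k)] at h1
    have h2 := mul_le_of_le_one_right (norm_nonneg
      (WithLp.toLp 2 ((slackMatrix P q * homogenize Θ).col k)))
      (Finset.prod_le_one (s := Finset.univ.erase k) (fun _ _ => norm_nonneg _)
        fun k _ => (hnorm k).1)
    linarith
  choose f hf using fun k => (hnorm k).2 (hone k)
  -- A repeated coordinate vector would make the determinant vanish.
  have hinj : Function.Injective f := by
    intro k l hkl
    by_contra hne
    have h0 : (slackMatrix P q * homogenize Θ).det = 0 :=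
      Matrix.det_zero_of_column_eq hne fun i => by
        have := congrFun ((hf k).trans ((congrArg (fun m => Pi.single m 1) hkl).trans (hf l).symm)) i
        exact this
    rw [h0, abs_zero] at hdet
    linarith
  exact ⟨Equiv.ofBijective f (Finite.injective_iff_bijective.1 hinj), hf⟩

theorem isDualMaxVol_iff (hη : η ∈ Set.Icc (0 : ℝ) 1) (hH : IsColStochastic H)
    (hHη : IsExpanded η H) (hPq : P.mulVec q = 0) (hq : ∑ i, q i = 1) (hq_pos : ∀ i, 0 < q i)
    (hq_lt : ∀ i, q i < (η + (1 - η) * (2 / ((d + 1 : ℕ) : ℝ))) / 2)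
    (hdet : (slackMatrix P q).det ≠ 0) {Θ₁ : Matrix (Fin d) (Fin (d + 1)) ℝ}
    (hΘ₁ : slackMatrix P q * homogenize Θ₁ = 1) :
    IsDualMaxVol (r := d + 1) (P * H) Θ ↔
      ∃ σ : Equiv.Perm (Fin (d + 1)), Θ = Θ₁.submatrix id σ := by
  have hfeas : Θ₁ ∈ dualFeasible (d + 1) (P * H) :=
    mem_dualFeasible_of_slackMatrix_mul hH hq_pos hΘ₁
  obtain ⟨c, hc0, hct, hc⟩ := exists_volume_colHull_eq d
  have hvol : ∀ A B : Matrix (Fin d) (Fin (d + 1)) ℝ,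
      MeasureTheory.volume (colHull A) ≤ MeasureTheory.volume (colHull B) ↔
        |(slackMatrix P q * homogenize A).det| ≤ |(slackMatrix P q * homogenize B).det| := by
    intro A B
    rw [hc, hc, ENNReal.mul_le_mul_iff_left hc0 hct, ENNReal.ofReal_le_ofReal_iff (abs_nonneg _),
      Matrix.det_mul, Matrix.det_mul, abs_mul, abs_mul, mul_le_mul_iff_right₀ (abs_pos.2 hdet)]
  constructor
  · rintro ⟨hΘ, hmax⟩
    have h1 := (hvol Θ₁ Θ).1 (hmax hfeas)
    rw [hΘ₁, Matrix.det_one, abs_one] at h1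
    obtain ⟨σ, hσ⟩ := exists_perm_of_one_le_abs_det_slack hη hHη hPq hq hq_pos hq_lt hΘ h1
    refine ⟨σ, ?_⟩
    ext a k
    have h2 : Θ.col k = Θ₁.col (σ k) := by
      rw [← mulVec_slackMatrix_mulVec hΘ₁ (Θ.col k), ← Matrix.mulVec_single_one Θ₁, ← hσ k]
      congr 1
      ext i
      rw [slackMatrix_mulVec, Matrix.col_apply, slackMatrix_mul_homogenize]
      rfl
    exact congrFun h2 a
  · rintro ⟨σ, rfl⟩
    refine ⟨mem_dualFeasible_submatrix (r := d + 1) σ hfeas, fun Ψ hΨ => ?_⟩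
    have h := (hvol Ψ Θ₁).2 (by
      rw [hΘ₁, Matrix.det_one, abs_one]
      exact abs_det_slack_le_one hη hHη hPq hq hq_pos hq_lt hΨ)
    have h' := h.trans_eq (congrArg MeasureTheory.volume (colHull_submatrix Θ₁ σ).symm)
    exact h'

end Maximizer

theorem mainTheorem3 (r n : ℕ) (η : ℝ) (hη : η ∈ Set.Icc (0 : ℝ) 1)
    (Y : Matrix (Fin (r - 1)) (Fin n) ℝ) (P : Matrix (Fin (r - 1)) (Fin r) ℝ)
    (H : Matrix (Fin r) (Fin n) ℝ) (hY : Y = P * H) (hP : P.rank = r - 1)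
    (hH : IsColStochastic H) (hHη : IsExpanded η H)
    (q : Fin r → ℝ) (hPq : P.mulVec q = 0) (hq : ∑ i, q i = 1)
    (hq_pos : ∀ i, 0 < q i)
    (hq_lt : ∀ i, q i < ((r : ℝ) * η + 2 * (1 - η)) / (2 * (r : ℝ))) :
    (∃ Θ₀, IsPolarMatrix P Θ₀) ∧
      ∀ Θ₀, IsPolarMatrix P Θ₀ →
        ∀ Θ : Matrix (Fin (r - 1)) (Fin r) ℝ,
          IsDualMaxVol Y Θ ↔ ∃ σ : Equiv.Perm (Fin r), Θ = Θ₀.submatrix id σ := by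
  obtain _ | d := r
  · simp at hq
  have hq_lt' : ∀ i, q i < (η + (1 - η) * (2 / ((d + 1 : ℕ) : ℝ))) / 2 := fun i => by
    refine (hq_lt i).trans_eq ?_
    have : ((d + 1 : ℕ) : ℝ) ≠ 0 := by positivity
    field_simp
  subst hY
  have hdet := det_slackMatrix_ne_zero (d := d) hP hPq hq hq_pos
  obtain ⟨Θ₁, hΘ₁⟩ := exists_slackMatrix_mul_homogenize_eq (d := d) hPq hq hdet
    (1 : Matrix (Fin (d + 1)) (Fin (d + 1)) ℝ) (fun j => by simp [Matrix.one_apply])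
  have hpolar := isPolarMatrix_of_slackMatrix_mul hPq hq hq_pos hdet hΘ₁
  refine ⟨⟨Θ₁, hpolar⟩, fun Θ₀ hΘ₀ Θ => ?_⟩
  refine (isDualMaxVol_iff hη hH hHη hPq hq hq_pos hq_lt' hdet hΘ₁).trans ?_
  -- An arbitrary polar matrix is a column permutation of the one with slack matrix `1`, so the two
  -- orbits agree.
  obtain ⟨τ, rfl⟩ := hpolar.exists_submatrix_eq hΘ₀
  constructor
  · rintro ⟨σ, rfl⟩
    refine ⟨σ.trans τ.symm, ?_⟩
    ext a k
    simp
  · rintro ⟨σ, rfl⟩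
    exact ⟨σ.trans τ, rfl⟩
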